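/- Let $k$ be a perfect field of characteristic $p>0$. Let $\mathfrak h$ be a finite-dimensional abelian restricted Lie algebra over $k$, let $\mathfrak g$ be a one-dimensional restricted Lie algebra with generator $z\neq 0$ satisfying $z^{p}+\lambda z=0$ for some $\lambda\in k$ (here $x\mapsto x^p$ is the restricted map), and let $\rho$ be an algebraic representation of $\mathfrak g$ on $\mathfrak h$, that is, a linear map $\rho:\mathfrak g\to\operatorname{End}_k(\mathfrak h)$ with $\rho_{[x,y]}=[\rho_x,\rho_y]$, $\rho_{x^p}=(\rho_x)^p$, $\rho_x([a,b])=[\rho_x(a),b]+[a,\rho_x(b)]$ and $\rho_x(a^p)=(\operatorname{ad}a)^{p-1}(\rho_x(a))$. Put $T=(\mathfrak g,\mathfrak h,\rho)$. Let $A=u(\mathfrak h)$ be the restricted universal enveloping algebra, with elements of $\mathfrak h$ primitive, and $A^+=\ker\epsilon$. Let $\Omega A=T(A^+)$ be the cobar construction, with $d^1(a)=-\overline\Delta(a)$ and $d^2(a\otimes b)=-\overline\Delta(a)\otimes b+a\otimes\overline\Delta(b)$, where $\overline\Delta(a)=\Delta(a)-a\otimes1-1\otimes a$, and let $Z^2$,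 $B^2$, $H^2(\Omega A)=Z^2/B^2$ be its cocycles, coboundaries and cohomology in degree $2$. Extend $\rho_z$ to a derivation of $A$, and let $z$ act on $A\otimes A$ by $\rho_z\otimes1+1\otimes\rho_z$, again written $\rho_z$. On $\mathfrak h$, $A^+$ and $A^+\otimes A^+$ put $\boldsymbol\Phi_z(a)=a^p+\rho_z^{p-1}(a)+\lambda a$. Let $\mathcal E^2$ be the set of pairs $(\Theta,\chi)\in A^+\times Z^2$ with $\rho_z(\Theta)=0$ and $\boldsymbol\Phi_z(\chi)=d^1(\Theta)$, modulo the equivalence relation $(\Theta',\chi')\sim(\Theta,\chi)$ if and only if there is $a\in A^+$ with $\Theta'-\Theta=\boldsymbol\Phi_z(a)$ and $\chi'-\chi=d^1(a)$. Let $\mathcal H^2(T)$ be the set of those equivalence classes in $\mathcal E^2$ that contain no pair $(\Theta,\chi)$ with $\chi\in B^2$, and let $q:\mathcal H^2(T)\to H^2(\Omega A)$ be the map $[(\Theta,\chi)]\mapsto[\chi]$. A class $\xi\in H^2(\Omega A)$ is called admissible if, for a cocycle $\chi$ representing it, there is $a\in A^+$ with $\boldsymbol\Phi_z(\chi)=d^1(a)$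 and $\rho_z(a)=0$. Finally, let $\operatorname{Ker}\rho_z$ and $\operatorname{Im}\boldsymbol\Phi_z$ denote the kernel of $\rho_z:\mathfrak h\to\mathfrak h$ and the image of $\boldsymbol\Phi_z:\mathfrak h\to\mathfrak h$, and let the additive group $\mathfrak h$ act on $\operatorname{Ker}\rho_z$ by $\Theta.x=x+\boldsymbol\Phi_z(\Theta)$. Let $\xi\in H^2(\Omega A)$ be a nonzero admissible element. Then: (1) The points of the fiber $q^{-1}(\xi)$ are in one-to-one correspondence with the $\mathfrak h$-orbits in $\operatorname{Ker}\rho_z$. More precisely, there is a pair $(\Theta_0,\chi_0)\in\mathcal E^2$ with $[\chi_0]=\xi$, and for every such pair the map $x\mapsto[(\Theta_0+x,\chi_0)]$ induces a bijection from the set of $\mathfrak h$-orbits in $\operatorname{Ker}\rho_z$ onto $q^{-1}(\xi)$. (2) The map $q$ is injective if and only if $\operatorname{Ker}\rho_z=\operatorname{Im}\boldsymbol\Phi_z$. -/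

import Mathlib

open scoped TensorProduct

namespace ConnHopf

noncomputable section

/-! ### Restricted Lie algebras -/

/-- The Jacobson term `s_i(x, y)`: `i • s_i(x, y)` is the coefficient of `t ^ (i - 1)` in
`(ad (t x + y)) ^ (p - 1) (x)`. This coefficient is the sum, over the words of length `p - 1` in
`x` and `y` with exactly `i - 1` letters `x`, of the corresponding products of `ad x` and `ad y`,
applied to `x`. -/
def jacobsonTerm (k : Type*) [Field k] (p : ℕ) {L : Type*} [LieRing L] [LieAlgebra k L]
    (i : ℕ) (x y : L) : L :=
  (i : k)⁻¹ • ∑ w : Fin (p - 1) → Bool,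
    if (Finset.univ.filter fun j => w j = true).card = i - 1 then
      (List.ofFn fun j => LieAlgebra.ad k L (if w j = true then x else y)).prod x
    else 0

/-- A restricted Lie algebra over a field `k` of characteristic `p`: a Lie algebra together with
a `p`-map `x ↦ x^[p]`. -/
class RestrictedLieAlgebra (k : Type*) [Field k] (p : ℕ) (L : Type*) [LieRing L]
    [LieAlgebra k L] where
  pmap : L → L
  pmap_smul : ∀ (c : k) (x : L), pmap (c • x) = c ^ p • pmap x
  ad_pmap : ∀ x : L, LieAlgebra.ad k L (pmap x) = LieAlgebra.ad k L x ^ p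
  pmap_add : ∀ x y : L,
    pmap (x + y) = pmap x + pmap y + ∑ i ∈ Finset.Icc 1 (p - 1), jacobsonTerm k p i x y

/-- The `p`-map of a restricted Lie algebra. -/
abbrev pmap (k : Type*) [Field k] (p : ℕ) {L : Type*} [LieRing L] [LieAlgebra k L]
    [RestrictedLieAlgebra k p L] (x : L) : L :=
  RestrictedLieAlgebra.pmap k p x

section Abelian

variable {k : Type*} [Field k] {p : ℕ} [Fact p.Prime] {L : Type*} [LieRing L] [LieAlgebra k L]
  [IsLieAbelian L]

theorem ad_eq_zero_of_abelian (x : L) : LieAlgebra.ad k L x = 0 := by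
  ext y
  simp [trivial_lie_zero]

theorem jacobsonTerm_of_abelian (i : ℕ) (x y : L) : jacobsonTerm k p i x y = 0 := by
  have hp : p - 1 ≠ 0 := by
    have := (Fact.out : p.Prime).two_le
    omega
  obtain ⟨m, hm⟩ := Nat.exists_eq_succ_of_ne_zero hp
  unfold jacobsonTerm
  rw [hm]
  simp [ad_eq_zero_of_abelian]

theorem pmap_add_of_abelian [RestrictedLieAlgebra k p L] (x y : L) :
    pmap k p (x + y) = pmap k p x + pmap k p y := by
  simp [pmap, RestrictedLieAlgebra.pmap_add, jacobsonTerm_of_abelian]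

end Abelian

/-! ### The restricted universal enveloping algebra and its bialgebra structure -/

/-- The relations `x ^ p = x^[p]`, for `x` in `L`, in the universal enveloping algebra of `L`. -/
inductive RestrictedRel (k : Type*) [Field k] (p : ℕ) (L : Type*) [LieRing L] [LieAlgebra k L]
    [RestrictedLieAlgebra k p L] :
    UniversalEnvelopingAlgebra k L → UniversalEnvelopingAlgebra k L → Prop
  | pow (x : L) : RestrictedRel k p L (UniversalEnvelopingAlgebra.ι k x ^ p)
      (UniversalEnvelopingAlgebra.ι k (pmap k p x))

/-- The restricted universal enveloping algebra `u(L)`. -/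
def RestrictedEnveloping (k : Type*) [Field k] (p : ℕ) (L : Type*) [LieRing L] [LieAlgebra k L]
    [RestrictedLieAlgebra k p L] :=
  RingQuot (RestrictedRel k p L)

namespace RestrictedEnveloping

attribute [local instance] LieRing.ofAssociativeRing

variable (k : Type*) [Field k] (p : ℕ) {L : Type*} [LieRing L] [LieAlgebra k L]
    [RestrictedLieAlgebra k p L]

instance : Ring (RestrictedEnveloping k p L) :=
  inferInstanceAs (Ring (RingQuot (RestrictedRel k p L)))

instance : Algebra k (RestrictedEnveloping k p L) :=
  inferInstanceAs (Algebra k (RingQuot (RestrictedRel k p L)))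

/-- The quotient map from `U(L)` to `u(L)`. -/
def mk : UniversalEnvelopingAlgebra k L →ₐ[k] RestrictedEnveloping k p L :=
  RingQuot.mkAlgHom k (RestrictedRel k p L)

/-- The canonical map from `L` to `u(L)`. -/
def ι : L →ₗ[k] RestrictedEnveloping k p L :=
  (mk k p).toLinearMap ∘ₗ (UniversalEnvelopingAlgebra.ι k : L →ₗ⁅k⁆ _).toLinearMap

theorem ι_apply (x : L) : ι k p x = mk k p (UniversalEnvelopingAlgebra.ι k x) := rfl

theorem ι_lie (x y : L) : ι k p ⁅x, y⁆ = ι k p x * ι k p y - ι k p y * ι k p x := by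
  simp [ι_apply, LieRing.of_associative_ring_bracket]

theorem ι_pow (x : L) : ι k p x ^ p = ι k p (pmap k p x) := by
  rw [ι_apply, ι_apply, ← map_pow]
  exact RingQuot.mkAlgHom_rel k (RestrictedRel.pow x)

variable {k p}

@[ext 1100]
theorem algHom_ext {R : Type*} [Ring R] [Algebra k R]
    {f f' : RestrictedEnveloping k p L →ₐ[k] R} (h : ∀ x, f (ι k p x) = f' (ι k p x)) :
    f = f' := by
  apply RingQuot.ringQuot_ext'
  apply UniversalEnvelopingAlgebra.hom_ext
  ext x
  exact h x

/-- A linear map to an associative algebra that respects brackets, as a map of Lie algebras. -/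
def toLieHom {R : Type*} [Ring R] [Algebra k R] (f : L →ₗ[k] R)
    (hlie : ∀ x y, f ⁅x, y⁆ = f x * f y - f y * f x) : L →ₗ⁅k⁆ R :=
  { f with map_lie' := fun {x y} => by simp [hlie, LieRing.of_associative_ring_bracket] }

/-- The universal property of `u(L)`: a linear map to an associative algebra that respects
brackets and `p`-maps extends to an algebra map. -/
def lift {R : Type*} [Ring R] [Algebra k R] (f : L →ₗ[k] R)
    (hlie : ∀ x y, f ⁅x, y⁆ = f x * f y - f y * f x) (hpow : ∀ x, f x ^ p = f (pmap k p x)) :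
    RestrictedEnveloping k p L →ₐ[k] R :=
  RingQuot.liftAlgHom k (s := RestrictedRel k p L)
    ⟨UniversalEnvelopingAlgebra.lift k (toLieHom f hlie), by
      rintro _ _ ⟨x⟩
      rw [map_pow, UniversalEnvelopingAlgebra.lift_ι_apply,
        UniversalEnvelopingAlgebra.lift_ι_apply]
      exact hpow x⟩

@[simp]
theorem lift_ι {R : Type*} [Ring R] [Algebra k R] (f : L →ₗ[k] R)
    (hlie : ∀ x y, f ⁅x, y⁆ = f x * f y - f y * f x) (hpow : ∀ x, f x ^ p = f (pmap k p x))
    (x : L) : lift f hlie hpow (ι k p x) = f x := by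
  refine (RingQuot.liftAlgHom_mkAlgHom_apply k (s := RestrictedRel k p L) _ _ _).trans ?_
  exact UniversalEnvelopingAlgebra.lift_ι_apply k (toLieHom f hlie) x

variable [Fact p.Prime]

variable (k p L) in
/-- The counit of `u(L)`, with `ε(x) = 0` for `x` in `L`. -/
def counitHom : RestrictedEnveloping k p L →ₐ[k] k :=
  lift 0 (by simp) (by simp [(Fact.out : p.Prime).ne_zero])

@[simp]
theorem counitHom_ι (x : L) : counitHom k p L (ι k p x) = 0 := by
  simp [counitHom]

instance : Nontrivial (RestrictedEnveloping k p L) :=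
  (counitHom k p L).toRingHom.domain_nontrivial

variable [CharP k p]

instance : CharP (RestrictedEnveloping k p L) p := charP_of_injective_algebraMap (algebraMap k _).injective p

instance : CharP (RestrictedEnveloping k p L ⊗[k] RestrictedEnveloping k p L) p :=
  charP_of_injective_algebraMap (algebraMap k _).injective p

variable (k p L) in
/-- The comultiplication of `u(L)`, with `Δ(x) = x ⊗ 1 + 1 ⊗ x` for `x` in `L`. -/
def comulHom : RestrictedEnveloping k p L →ₐ[k]
    RestrictedEnveloping k p L ⊗[k] RestrictedEnveloping k p L :=
  lift
    (Algebra.TensorProduct.includeLeft.toLinearMap ∘ₗ ι k p +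
      Algebra.TensorProduct.includeRight.toLinearMap ∘ₗ ι k p)
    (fun x y => by
      simp [ι_lie, TensorProduct.sub_tmul, TensorProduct.tmul_sub, mul_add, add_mul]
      abel)
    (fun x => by
      have hc : Commute (ι k p x ⊗ₜ[k] (1 : RestrictedEnveloping k p L))
          ((1 : RestrictedEnveloping k p L) ⊗ₜ[k] ι k p x) := by
        simp [Commute, SemiconjBy]
      simp [add_pow_char_of_commute p hc, ι_pow])

@[simp]
theorem comulHom_ι (x : L) :
    comulHom k p L (ι k p x) = ι k p x ⊗ₜ[k] 1 + 1 ⊗ₜ[k] ι k p x := by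
  simp [comulHom]

instance : Bialgebra k (RestrictedEnveloping k p L) :=
  Bialgebra.ofAlgHom (comulHom k p L) (counitHom k p L)
    (by
      ext x
      simp [TensorProduct.add_tmul, TensorProduct.tmul_add, Algebra.TensorProduct.one_def]
      abel)
    (by
      ext x
      simp)
    (by
      ext x
      simp)

@[simp]
theorem counit_ι (x : L) :
    Coalgebra.counit (R := k) (A := RestrictedEnveloping k p L) (ι k p x) = 0 :=
  counitHom_ι x

@[simp]
theorem comul_ι (x : L) :
    Coalgebra.comul (R := k) (A := RestrictedEnveloping k p L) (ι k p x) =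
      ι k p x ⊗ₜ[k] 1 + 1 ⊗ₜ[k] ι k p x :=
  comulHom_ι x

end RestrictedEnveloping

namespace RestrictedEnveloping

variable {k : Type*} [Field k] {p : ℕ} {L : Type*} [LieRing L] [LieAlgebra k L]
    [RestrictedLieAlgebra k p L]

theorem adjoin_range_ι : Algebra.adjoin k (Set.range (ι k p (L := L))) = ⊤ := by
  let S := Algebra.adjoin k (Set.range (ι k p (L := L)))
  let f : L →ₗ[k] S := (ι k p).codRestrict (Subalgebra.toSubmodule S)
    (fun x => Algebra.subset_adjoin ⟨x, rfl⟩)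
  have hf : ∀ x, (f x : RestrictedEnveloping k p L) = ι k p x := fun x => rfl
  let F : RestrictedEnveloping k p L →ₐ[k] S := lift f
    (fun x y => Subtype.ext (by
      rw [AddSubgroupClass.coe_sub, MulMemClass.coe_mul, MulMemClass.coe_mul, hf, hf, hf, ι_lie]))
    (fun x => Subtype.ext (by rw [SubmonoidClass.coe_pow, hf, hf, ι_pow]))
  have hF : S.val.comp F = AlgHom.id k _ := by
    ext x
    simp [F, hf]
  rw [eq_top_iff]
  intro a _
  have h := DFunLike.congr_fun hF a
  simp only [AlgHom.comp_apply, AlgHom.id_apply] at h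
  rw [← h]
  exact (F a).2

variable [IsLieAbelian L]

theorem mul_comm_of_abelian (a b : RestrictedEnveloping k p L) : a * b = b * a := by
  have hc : ∀ x ∈ Set.range (ι k p (L := L)), ∀ y ∈ Set.range (ι k p (L := L)),
      x * y = y * x := by
    rintro _ ⟨x, rfl⟩ _ ⟨y, rfl⟩
    have := ι_lie k p x y
    rw [trivial_lie_zero, map_zero] at this
    exact (sub_eq_zero.mp this.symm)
  have ha : a ∈ Algebra.adjoin k (Set.range (ι k p (L := L))) := by simp [adjoin_range_ι]
  have hb : b ∈ Algebra.adjoin k (Set.range (ι k p (L := L))) := by simp [adjoin_range_ι]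
  have := (Algebra.isMulCommutative_adjoin k hc).is_comm.comm ⟨a, ha⟩ ⟨b, hb⟩
  exact congrArg Subtype.val this

instance : CommRing (RestrictedEnveloping k p L) :=
  { (inferInstance : Ring (RestrictedEnveloping k p L)) with
    mul_comm := mul_comm_of_abelian }

/-- Auxiliary algebra map `u(L) → u(L)[ε]`, `x ↦ x + ε D(x)` for `x` in `L`. -/
def derivAux [Fact p.Prime] [CharP k p] (D : Module.End k L) (hD : ∀ x, D (pmap k p x) = 0) :
    RestrictedEnveloping k p L →ₐ[k]
      TrivSqZeroExt (RestrictedEnveloping k p L) (RestrictedEnveloping k p L) :=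
  lift
    ((TrivSqZeroExt.inlAlgHom k (RestrictedEnveloping k p L)
        (RestrictedEnveloping k p L)).toLinearMap ∘ₗ ι k p +
      (TrivSqZeroExt.inrHom (RestrictedEnveloping k p L)
        (RestrictedEnveloping k p L)).restrictScalars k ∘ₗ ι k p ∘ₗ D)
    (fun x y => by
      rw [trivial_lie_zero, map_zero, mul_comm, sub_self])
    (fun x => by
      ext
      · simp [ι_pow]
      · simp [hD, ← Nat.cast_smul_eq_nsmul k])

theorem fst_derivAux [Fact p.Prime] [CharP k p] (D : Module.End k L)
    (hD : ∀ x, D (pmap k p x) = 0) (a : RestrictedEnveloping k p L) :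
    (derivAux D hD a).fst = a := by
  have h : (TrivSqZeroExt.fstHom k (RestrictedEnveloping k p L)
      (RestrictedEnveloping k p L)).comp (derivAux D hD) = AlgHom.id k _ := by
    ext x
    simp [derivAux]
  exact DFunLike.congr_fun h a

/-- The derivation of `u(L)`, for `L` abelian, that extends a linear endomorphism `D` of `L`
which kills all `x^[p]`. -/
def deriv [Fact p.Prime] [CharP k p] (D : Module.End k L) (hD : ∀ x, D (pmap k p x) = 0) :
    Derivation k (RestrictedEnveloping k p L) (RestrictedEnveloping k p L) :=
  Derivation.mk' ((TrivSqZeroExt.sndHom (RestrictedEnveloping k p L)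
    (RestrictedEnveloping k p L)).restrictScalars k ∘ₗ (derivAux D hD).toLinearMap)
    (fun a b => by
      simp [fst_derivAux, mul_comm])

@[simp]
theorem deriv_ι [Fact p.Prime] [CharP k p] (D : Module.End k L) (hD : ∀ x, D (pmap k p x) = 0)
    (x : L) : deriv D hD (ι k p x) = ι k p (D x) := by
  simp [deriv, derivAux]

end RestrictedEnveloping

/-! ### The cobar construction in low degrees -/

section Cobar

variable (k : Type*) [Field k] (A : Type*) [Ring A] [Bialgebra k A]

/-- The augmentation ideal `A⁺ = ker ε`. -/
def augIdeal : Submodule k A := LinearMap.ker (Coalgebra.counit (R := k) (A := A))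

/-- The reduced comultiplication `Δ(a) - a ⊗ 1 - 1 ⊗ a`. -/
def redComul : A →ₗ[k] A ⊗[k] A :=
  Coalgebra.comul - (TensorProduct.mk k A A).flip 1 - TensorProduct.mk k A A 1

/-- The degree two part `A⁺ ⊗ A⁺` of the cobar construction `ΩA = T(A⁺)`, as a subspace of
`A ⊗ A`. -/
def cobarTwo : Submodule k (A ⊗[k] A) :=
  LinearMap.range (TensorProduct.map (augIdeal k A).subtype (augIdeal k A).subtype)

/-- The differential `d¹` of the cobar construction (on `A⁺`, the degree one part). -/
def d₁ : A →ₗ[k] A ⊗[k] A := -redComul k A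

/-- The differential `d²` of the cobar construction (on `A⁺ ⊗ A⁺`):
`a ⊗ b` is sent to minus the reduced comultiplication of `a` tensor `b`, plus `a` tensor the
reduced comultiplication of `b`. -/
def d₂ : A ⊗[k] A →ₗ[k] A ⊗[k] (A ⊗[k] A) :=
  -((TensorProduct.assoc k A A A).toLinearMap ∘ₗ (redComul k A).rTensor A) +
    (redComul k A).lTensor A

/-- The 2-cocycles `Z²(ΩA)`. -/
def Z₂ : Submodule k (A ⊗[k] A) := cobarTwo k A ⊓ LinearMap.ker (d₂ k A)

/-- The 2-coboundaries `B²(ΩA)`. -/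
def B₂ : Submodule k (A ⊗[k] A) := (augIdeal k A).map (d₁ k A)

/-- The second cohomology `H²(ΩA)`. -/
abbrev H₂ := Z₂ k A ⧸ (B₂ k A).submoduleOf (Z₂ k A)

end Cobar

/-! ### Algebraic representations and types -/

/-- An algebraic representation of a restricted Lie algebra `𝔤` on a restricted Lie algebra `𝔥`.
In the last axiom the original form is that of `p - 1` brackets with `a` on the right of
`ρ_x(a)`; as `(-1) ^ (p - 1) = 1` in `k`, this equals `(ad a) ^ (p - 1) (ρ_x(a))`. -/
structure AlgebraicRep (k : Type*) [Field k] (p : ℕ) (𝔤 𝔥 : Type*)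
    [LieRing 𝔤] [LieAlgebra k 𝔤] [RestrictedLieAlgebra k p 𝔤]
    [LieRing 𝔥] [LieAlgebra k 𝔥] [RestrictedLieAlgebra k p 𝔥] where
  ρ : 𝔤 →ₗ[k] Module.End k 𝔥
  map_lie : ∀ x y : 𝔤, ρ ⁅x, y⁆ = ρ x * ρ y - ρ y * ρ x
  map_pmap : ∀ x : 𝔤, ρ (pmap k p x) = ρ x ^ p
  deriv_lie : ∀ (x : 𝔤) (a b : 𝔥), ρ x ⁅a, b⁆ = ⁅ρ x a, b⁆ + ⁅a, ρ x b⁆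
  deriv_pmap : ∀ (x : 𝔤) (a : 𝔥), ρ x (pmap k p a) = (LieAlgebra.ad k 𝔥 a ^ (p - 1)) (ρ x a)

/-- A type `T = (𝔤, 𝔥, ρ)` with `dim 𝔤 = 1`, together with a generator `z` of `𝔤` and the
scalar `lam` for which `z^[p] + lam • z = 0`. -/
structure PointedType (k : Type*) [Field k] (p : ℕ) (𝔤 𝔥 : Type*)
    [LieRing 𝔤] [LieAlgebra k 𝔤] [RestrictedLieAlgebra k p 𝔤]
    [LieRing 𝔥] [LieAlgebra k 𝔥] [RestrictedLieAlgebra k p 𝔥]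
    extends AlgebraicRep k p 𝔤 𝔥 where
  finrank_eq_one : Module.finrank k 𝔤 = 1
  z : 𝔤
  z_ne_zero : z ≠ 0
  lam : k
  z_rel : pmap k p z + lam • z = 0

/-- The operators `𝒟^m`: `𝒟^0 = id` and
`𝒟^m = P ∘ 𝒟^(m-1) + δ ^ (p ^ m - p ^ (m-1)) ∘ 𝒟^(m-1)`,
where `P` is the `p`-th power map and `δ` the action of `z`. -/
def dOperator {k : Type*} [Field k] (p : ℕ) {M : Type*} [AddCommGroup M] [Module k M]
    (P : M → M) (δ : Module.End k M) : ℕ → M → M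
  | 0 => fun a => a
  | m + 1 => fun a =>
      P (dOperator p P δ m a) + (δ ^ (p ^ (m + 1) - p ^ m)) (dOperator p P δ m a)

/-- The `z`-operator `Φ_z = 𝒟^1 + lam 𝒟^0` for `z ^ p + lam z = 0`. -/
def zOperator {k : Type*} [Field k] (p : ℕ) {M : Type*} [AddCommGroup M] [Module k M]
    (P : M → M) (δ : Module.End k M) (lam : k) (a : M) : M :=
  dOperator p P δ 1 a + lam • dOperator p P δ 0 a

theorem zOperator_eq {k : Type*} [Field k] (p : ℕ) {M : Type*} [AddCommGroup M] [Module k M]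
    (P : M → M) (δ : Module.End k M) (lam : k) (a : M) :
    zOperator p P δ lam a = P a + (δ ^ (p - 1)) a + lam • a := by
  simp [zOperator, dOperator]

theorem zOperator_add {k : Type*} [Field k] (p : ℕ) {M : Type*} [AddCommGroup M] [Module k M]
    (P : M → M) (hP : ∀ a b, P (a + b) = P a + P b) (δ : Module.End k M) (lam : k) (a b : M) :
    zOperator p P δ lam (a + b) = zOperator p P δ lam a + zOperator p P δ lam b := by
  simp only [zOperator_eq, hP, map_add, smul_add]
  abel

namespace PointedType

variable {k : Type*} [Field k] {p : ℕ} [Fact p.Prime] {𝔤 𝔥 : Type*}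
    [LieRing 𝔤] [LieAlgebra k 𝔤] [RestrictedLieAlgebra k p 𝔤]
    [LieRing 𝔥] [LieAlgebra k 𝔥] [RestrictedLieAlgebra k p 𝔥] [IsLieAbelian 𝔥]
    (T : PointedType k p 𝔤 𝔥)

/-- The action `ρ_z` on `𝔥`. -/
abbrev ρz : Module.End k 𝔥 := T.ρ T.z

theorem ρz_pmap (x : 𝔥) : T.ρz (pmap k p x) = 0 := by
  have hp : p - 1 ≠ 0 := by
    have := (Fact.out : p.Prime).two_le
    omega
  rw [T.deriv_pmap, ad_eq_zero_of_abelian, zero_pow hp, LinearMap.zero_apply]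

/-- `Φ_z` on `𝔥`. -/
def Φ₀ : 𝔥 → 𝔥 := zOperator p (pmap k p) T.ρz T.lam

theorem Φ₀_add (x y : 𝔥) : T.Φ₀ (x + y) = T.Φ₀ x + T.Φ₀ y :=
  zOperator_add p _ pmap_add_of_abelian _ _ x y

theorem ρz_Φ₀ (x : 𝔥) : T.ρz (T.Φ₀ x) = 0 := by
  have hp : p - 1 + 1 = p := Nat.sub_add_cancel (Fact.out : p.Prime).one_le
  have h := congrArg (fun w => T.ρ w x) T.z_rel
  simp only [map_add, map_smul, T.map_pmap, map_zero, LinearMap.add_apply, LinearMap.smul_apply,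
    LinearMap.zero_apply] at h
  rw [Φ₀, zOperator_eq, map_add, map_add, ρz_pmap, zero_add, map_smul, ← Module.End.mul_apply,
    ← pow_succ', hp]
  exact h

/-- `Ker ρ_z` in `𝔥`. -/
def kerρz : Submodule k 𝔥 := LinearMap.ker T.ρz

/-- The action of the additive group `𝔥` on `Ker ρ_z` by `Θ.x = x + Φ_z(Θ)`. -/
instance : AddAction 𝔥 T.kerρz where
  vadd Θ x := ⟨x.1 + T.Φ₀ Θ, by
    have hx := x.2
    simp only [kerρz, LinearMap.mem_ker] at hx ⊢
    rw [map_add, hx, ρz_Φ₀, add_zero]⟩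
  zero_vadd x := Subtype.ext (by
    have h : T.Φ₀ 0 = 0 := by simpa using T.Φ₀_add 0 0
    change x.1 + T.Φ₀ 0 = x.1
    rw [h, add_zero])
  add_vadd Θ Θ' x := Subtype.ext (by
    change x.1 + T.Φ₀ (Θ + Θ') = x.1 + T.Φ₀ Θ' + T.Φ₀ Θ
    rw [Φ₀_add]
    abel)

/-- The set of `𝔥`-orbits in `Ker ρ_z`. -/
abbrev Orbits := AddAction.orbitRel.Quotient 𝔥 T.kerρz

variable [CharP k p]

/-- The Hopf algebra `A = u(𝔥)` of a type (only its bialgebra structure is used). -/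
abbrev A (_ : PointedType k p 𝔤 𝔥) := RestrictedEnveloping k p 𝔥

/-- The action `ρ_z` on `A = u(𝔥)`. -/
def δ₁ : Module.End k T.A := (RestrictedEnveloping.deriv T.ρz T.ρz_pmap).toLinearMap

/-- The action of the primitive element `z` on `A ⊗ A`. -/
def δ₂ : Module.End k (T.A ⊗[k] T.A) := T.δ₁.rTensor T.A + T.δ₁.lTensor T.A

/-- `Φ_z` in degree one. -/
def Φ₁ : T.A → T.A := zOperator p (fun a => a ^ p) T.δ₁ T.lam

/-- `Φ_z` in degree two. -/
def Φ₂ : T.A ⊗[k] T.A → T.A ⊗[k] T.A := zOperator p (fun a => a ^ p) T.δ₂ T.lam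

theorem Φ₁_add (a b : T.A) : T.Φ₁ (a + b) = T.Φ₁ a + T.Φ₁ b :=
  zOperator_add p _ (fun a b => add_pow_char a b p) _ _ a b

/-- On `𝔥`, viewed in `A`, the operator `Φ_z` of degree one is `Φ₀`. -/
theorem Φ₁_ι (x : 𝔥) :
    T.Φ₁ (RestrictedEnveloping.ι k p x) = RestrictedEnveloping.ι k p (T.Φ₀ x) := by
  have h : ∀ n : ℕ, (T.δ₁ ^ n) (RestrictedEnveloping.ι k p x) =
      RestrictedEnveloping.ι k p ((T.ρz ^ n) x) := by
    intro n
    induction n with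
    | zero => simp
    | succ n ih =>
      rw [pow_succ', Module.End.mul_apply, ih, pow_succ', Module.End.mul_apply]
      exact RestrictedEnveloping.deriv_ι _ _ _
  simp only [Φ₁, Φ₀, zOperator_eq, map_add, map_smul, h, RestrictedEnveloping.ι_pow]

/-! ### The cohomology sets -/

/-- The set `A⁺ × Z²(ΩA)`. -/
abbrev Pairs := augIdeal k T.A × Z₂ k T.A

/-- The subset `ℰ²(B, A)` of `A⁺ × Z²(ΩA)`. -/
def E₂ : Set T.Pairs :=
  {P | T.δ₁ P.1 = 0 ∧ T.Φ₂ P.2 = d₁ k T.A P.1}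

/-- The equivalence relation on `A⁺ × Z²(ΩA)`. -/
def pairSetoid : Setoid T.Pairs where
  r P Q := ∃ a ∈ augIdeal k T.A,
    (Q.1 : T.A) - P.1 = T.Φ₁ a ∧ (Q.2 : T.A ⊗[k] T.A) - P.2 = d₁ k T.A a
  iseqv := by
    have h0 : T.Φ₁ 0 = 0 := by simpa using T.Φ₁_add 0 0
    have hn : ∀ a, T.Φ₁ (-a) = -T.Φ₁ a := fun a => by
      have := T.Φ₁_add a (-a)
      rw [add_neg_cancel, h0] at this
      exact (neg_eq_of_add_eq_zero_right this.symm).symm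
    refine ⟨fun P => ⟨0, zero_mem _, by simp [h0], by simp⟩, ?_, ?_⟩
    · rintro P Q ⟨a, ha, h1, h2⟩
      exact ⟨-a, neg_mem ha, by rw [hn, ← h1, neg_sub], by rw [map_neg, ← h2, neg_sub]⟩
    · rintro P Q R ⟨a, ha, h1, h2⟩ ⟨b, hb, h3, h4⟩
      exact ⟨a + b, add_mem ha hb, by rw [Φ₁_add, ← h1, ← h3]; abel,
        by rw [map_add, ← h2, ← h4]; abel⟩

/-- `ℋ²(B, A)`, the set of equivalence classes in `ℰ²(B, A)`. -/
def HBA := Quotient (T.pairSetoid.comap (Subtype.val : T.E₂ → T.Pairs))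

/-- The class in `ℋ²(B, A)` of an element of `ℰ²(B, A)`. -/
def cls (P : T.E₂) : T.HBA := Quotient.mk _ P

/-- The subset `ℒ²(𝔤, 𝔥)` of `ℰ²(B, A)`, where the cocycle is a coboundary. -/
def L₂ : Set T.E₂ := {P | (P.1.2 : T.A ⊗[k] T.A) ∈ B₂ k T.A}

/-- The subset `ℋ²(𝔤, 𝔥)` of `ℋ²(B, A)`. -/
def Hgh : Set T.HBA := T.cls '' T.L₂

/-- `ℋ²(T)`, the complement of `ℋ²(𝔤, 𝔥)` in `ℋ²(B, A)`. -/
def HT : Set T.HBA := T.Hghᶜ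

/-- The map `[(Θ, χ)] ↦ [χ]` from `ℋ²(B, A)` to `H²(ΩA)`. -/
def qBA : T.HBA → H₂ k T.A :=
  Quotient.lift (fun P : T.E₂ => Submodule.Quotient.mk P.1.2) (by
    rintro P Q ⟨a, ha, -, h⟩
    refine ((Submodule.Quotient.eq _).mpr ?_).symm
    exact ⟨a, ha, h.symm⟩)

/-- The projection `q : ℋ²(T) → H²(ΩA)`, `[(Θ, χ)] ↦ [χ]`. -/
def q (c : T.HT) : H₂ k T.A := T.qBA c.1

/-- A class `ξ` in `H²(ΩA)` is admissible if for a cocycle `χ` that represents it there is some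
`a` in `A⁺` with `Φ_z(χ) = d¹(a)` (in particular `ξ` is `z`-characteristic) and `ρ_z(a) = 0`. -/
def IsAdmissible (ξ : H₂ k T.A) : Prop :=
  ∃ χ : Z₂ k T.A, Submodule.Quotient.mk χ = ξ ∧
    ∃ a ∈ augIdeal k T.A, T.Φ₂ χ = d₁ k T.A a ∧ T.δ₁ a = 0

end PointedType

end

end ConnHopf

open ConnHopf

/-! Fix `(Θ₀, χ₀)` in `ℰ²` with `[χ₀] = ξ`; admissibility is exactly the existence of such a pair.
If `[χ] = ξ` for another pair `(Θ, χ)`, then `χ₀ = χ + d¹(a)` for some `a`, and moving along the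
equivalence relation replaces `(Θ, χ)` by `(Θ + Φ_z(a), χ₀)`. Since `d¹ ∘ Φ_z = Φ_z ∘ d¹` (`d₁_Φ₁`)
and `ρ_z ∘ Φ_z = 0` (`δ₁_Φ₁`), the difference `x = Θ + Φ_z(a) - Θ₀` is killed by `d¹` and by `ρ_z`.
An element killed by `d¹` is primitive, and the primitive elements of `u(𝔥)` are those of `𝔥`
(`d₁_eq_zero_iff`), so `x` lies in `Ker ρ_z`. Two translates of `Θ₀` by `x` and `y` are equivalent
through some `a` with `d¹(a) = 0`, hence through some `a` in `𝔥`, which says that `y - x` lies in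
`Im Φ_z`: the fiber is the set of orbits.

The orbits are the cosets of `Im Φ_z` in `Ker ρ_z`. The argument applies to every nonempty fiber of
`q`, because `q` never takes the value zero, so `q` is injective exactly when there is only one
orbit.

The algebraic input is a Poincaré–Birkhoff–Witt theorem for `u(𝔥)` with `𝔥` abelian: it is a
quotient of a polynomial ring by polynomials with leading monomials `X_j ^ p`, so the monomials with
all exponents below `p` form a basis (`truncBasis`). In this basis `Δ` has binomial coefficients,
and those of the form `d_i` with `0 < d_i < p` are invertible in `k`, which determines the primitive
elements. -/

namespace ConnHopf

/-! ### Bases of polynomial rings and quotients from leading exponents -/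

section MonomialBases

open MvPolynomial

variable {σ k : Type*} [Field k] (m : MonomialOrder σ)

theorem linearIndependent_of_monic_degree {B : (σ →₀ ℕ) → MvPolynomial σ k}
    (hB : ∀ d, m.Monic (B d)) (hd : ∀ d, m.degree (B d) = d) : LinearIndependent k B := by
  classical
  rw [linearIndependent_iff]
  intro l hl
  by_contra hne
  obtain ⟨d, hds, hmax⟩ := l.support.exists_max_image m.toSyn (Finsupp.support_nonempty_iff.mpr hne)
  have h := congrArg (coeff d) hl
  rw [Finsupp.linearCombination_apply, Finsupp.sum, coeff_sum, Finset.sum_eq_single d, coeff_smul,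
    coeff_zero] at h
  · have h1 := (hB d).coeff_degree
    rw [hd] at h1
    rw [h1, smul_eq_mul, mul_one] at h
    exact Finsupp.mem_support_iff.mp hds h
  · intro e he hed
    rw [coeff_smul, m.coeff_eq_zero_of_lt, smul_zero]
    rw [hd]
    exact lt_of_le_of_ne (hmax e he) (fun h => hed (m.toSyn.injective h))
  · exact fun h => (h hds).elim

theorem span_eq_top_of_monic_degree {B : (σ →₀ ℕ) → MvPolynomial σ k}
    (hB : ∀ d, m.Monic (B d)) (hd : ∀ d, m.degree (B d) = d) :
    Submodule.span k (Set.range B) = ⊤ := by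
  classical
  have key : ∀ (s : m.syn) (d : σ →₀ ℕ), m.toSyn d = s →
      monomial d (1 : k) ∈ Submodule.span k (Set.range B) := by
    intro s
    induction s using WellFoundedLT.induction with
    | ind s ih =>
      rintro d rfl
      have h1 := (hB d).coeff_degree
      rw [hd] at h1
      have hmem : d ∈ (B d).support := by simp [h1]
      have hsum := (B d).support_sum_monomial_coeff
      rw [← Finset.add_sum_erase _ _ hmem, h1] at hsum
      rw [eq_sub_of_add_eq hsum]
      refine sub_mem (Submodule.subset_span ⟨d, rfl⟩) (Submodule.sum_mem _ fun e he => ?_)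
      rw [← mul_one (coeff e (B d)), ← smul_eq_mul, ← smul_monomial]
      refine Submodule.smul_mem _ _ (ih _ ?_ e rfl)
      have hle := m.le_degree (Finset.mem_of_mem_erase he)
      rw [hd] at hle
      exact lt_of_le_of_ne hle fun h => Finset.ne_of_mem_erase he (m.toSyn.injective h)
  rw [eq_top_iff]
  intro f _
  rw [← f.support_sum_monomial_coeff]
  refine Submodule.sum_mem _ fun e _ => ?_
  rw [← mul_one (coeff e f), ← smul_eq_mul, ← smul_monomial]
  exact Submodule.smul_mem _ _ (key _ e rfl)

variable [Fintype σ] (q : ℕ) (g : σ → MvPolynomial σ k)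

/-- The polynomials `X ^ (d mod q) * g ^ (d / q)`. -/
noncomputable def mixedMonomial (d : σ →₀ ℕ) : MvPolynomial σ k :=
  monomial (d.mapRange (· % q) (Nat.zero_mod q)) 1 * ∏ j, g j ^ (d j / q)

variable {q g}

theorem mixedMonomial_of_lt {d : σ →₀ ℕ} (h : ∀ j, d j < q) :
    mixedMonomial q g d = monomial d 1 := by
  have h1 : d.mapRange (· % q) (Nat.zero_mod q) = d := by
    ext j
    simp [Nat.mod_eq_of_lt (h j)]
  simp [mixedMonomial, h1, Nat.div_eq_of_lt (h _)]

/-- Multiplication by `g j` merely shifts the index, so multiples of the generators stay visible in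
the basis of mixed monomials and no division algorithm is needed. -/
theorem mixedMonomial_add_single (hq : 0 < q) (d : σ →₀ ℕ) (j : σ) :
    mixedMonomial q g (d + Finsupp.single j q) = mixedMonomial q g d * g j := by
  classical
  have h1 : (d + Finsupp.single j q).mapRange (· % q) (Nat.zero_mod q) =
      d.mapRange (· % q) (Nat.zero_mod q) := by
    ext i
    by_cases h : j = i
    · subst h; simp
    · simp [Finsupp.single_eq_of_ne' h]
  have h2 : ∀ i, g i ^ ((d + Finsupp.single j q) i / q) =
      g i ^ (d i / q) * (if i = j then g j else 1) := by
    intro i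
    by_cases h : i = j
    · subst h; simp [Nat.add_div_right _ hq, pow_succ]
    · simp [Finsupp.single_eq_of_ne h, h]
  simp only [mixedMonomial, h1, h2, Finset.prod_mul_distrib, Finset.prod_ite_eq', Finset.mem_univ,
    if_true, mul_assoc]

variable (hg : ∀ j, m.Monic (g j)) (hgd : ∀ j, m.degree (g j) = Finsupp.single j q)
include hg

theorem monic_mixedMonomial (d : σ →₀ ℕ) : m.Monic (mixedMonomial q g d) :=
  (m.monic_monomial_one).mul (MonomialOrder.Monic.prod fun j _ => (hg j).pow)

include hgd

theorem degree_mixedMonomial (d : σ →₀ ℕ) : m.degree (mixedMonomial q g d) = d := by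
  classical
  have hne : ∀ j, g j ^ (d j / q) ≠ 0 := fun j => pow_ne_zero _ (hg j).ne_zero
  rw [mixedMonomial, m.degree_mul (by simp) (Finset.prod_ne_zero_iff.mpr fun j _ => hne j),
    m.degree_prod fun j _ => hne j, m.degree_monomial, if_neg one_ne_zero]
  ext i
  simp only [m.degree_pow, hgd, Finsupp.add_apply, Finsupp.mapRange_apply, Finsupp.finsetSum_apply,
    Finsupp.smul_apply, smul_eq_mul]
  rw [Finset.sum_eq_single i (by intro j _ h; simp [Finsupp.single_eq_of_ne' h]) (by simp)]
  simp [Nat.mod_add_div']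

/-- The mixed monomials are linearly independent. Those with some exponent at least `q` span a space
containing the ideal, while those with all exponents below `q` are ordinary monomials; the latter
therefore stay independent modulo the ideal. -/
theorem linearIndependent_mk_monomial (hq : 0 < q) :
    LinearIndependent k fun d : σ → Fin q =>
      Ideal.Quotient.mkₐ k (Ideal.span (Set.range g))
        (monomial (Finsupp.equivFunOnFinite.symm fun j => (d j : ℕ)) 1) := by
  classical
  have hli := linearIndependent_of_monic_degree m (monic_mixedMonomial m hg)
    (degree_mixedMonomial m hg hgd)
  have htop := span_eq_top_of_monic_degree m (monic_mixedMonomial m hg)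
    (degree_mixedMonomial m hg hgd)
  set B := mixedMonomial q g with hBdef
  let S : Set (σ →₀ ℕ) := {d | ∃ j, q ≤ d j}
  -- Expand the coefficient of each generator in the basis `B`; the factor `g j` then raises the
  -- exponent at `j` by `q`, which puts the index in `S`.
  have hI : ∀ f ∈ Ideal.span (Set.range g), f ∈ Submodule.span k (B '' S) := by
    intro f hf
    obtain ⟨c, rfl⟩ := Ideal.mem_span_range_iff_exists_fun.mp hf
    refine Submodule.sum_mem _ fun j _ => ?_
    have hc : c j ∈ Submodule.span k (Set.range B) := by rw [htop]; trivial
    generalize c j = x at hc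
    induction hc using Submodule.span_induction with
    | mem x hx =>
      obtain ⟨d, rfl⟩ := hx
      rw [hBdef, ← mixedMonomial_add_single hq]
      exact Submodule.subset_span ⟨_, ⟨j, by simp⟩, rfl⟩
    | zero => simp
    | add x y _ _ hx hy => rw [add_mul]; exact add_mem hx hy
    | smul a x _ hx => rw [smul_mul_assoc]; exact Submodule.smul_mem _ _ hx
  let e : (σ → Fin q) → (σ →₀ ℕ) := fun d => Finsupp.equivFunOnFinite.symm fun j => (d j : ℕ)
  have he : Function.Injective e := fun d d' h => by
    funext j
    exact Fin.ext (DFunLike.congr_fun h j)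
  have hB : (fun d : σ → Fin q => monomial (e d) (1 : k)) = B ∘ e := by
    funext d
    exact (mixedMonomial_of_lt fun j => (d j).2).symm
  have hdisj : Disjoint (Submodule.span k (Set.range (B ∘ e)))
      (LinearMap.ker (Ideal.Quotient.mkₐ k (Ideal.span (Set.range g))).toLinearMap) := by
    have h1 : Disjoint (Set.range e) S := by
      rw [Set.disjoint_left]
      rintro _ ⟨d, rfl⟩ ⟨j, hj⟩
      exact absurd hj (not_le.mpr (d j).2)
    rw [Set.range_comp]
    refine (hli.disjoint_span_image h1).mono_right fun f hf => hI f ?_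
    exact Ideal.Quotient.eq_zero_iff_mem.mp hf
  have := (hli.comp e he).map hdisj
  rw [← hB] at this
  exact this

end MonomialBases

/-! ### Poincaré–Birkhoff–Witt basis of `u(L)` for abelian `L` -/

namespace RestrictedEnveloping

open MvPolynomial

variable {k : Type*} [Field k] {p : ℕ} [Fact p.Prime] {L : Type*} [LieRing L] [LieAlgebra k L]
  [RestrictedLieAlgebra k p L] {n : ℕ} (b : Module.Basis (Fin n) k L)

/-- The linear form in the variables `X i` with the coordinates of `x` as coefficients. -/
noncomputable def linForm : L →ₗ[k] MvPolynomial (Fin n) k := b.constr k X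

@[simp]
theorem linForm_basis (i : Fin n) : linForm b (b i) = X i := b.constr_basis k _ i

theorem linForm_eq (x : L) : linForm b x = ∑ i, b.repr x i • X i := by
  simp [linForm, Module.Basis.constr_apply_fintype]

variable (p) in
/-- The polynomials that present `u(L)`, for `L` abelian, as a quotient of a polynomial ring. -/
noncomputable def relPoly (j : Fin n) : MvPolynomial (Fin n) k :=
  X j ^ p - linForm b (pmap k p (b j))

-- The order must be graded: a linear form has total degree at most `1 < p`, whatever variables it
-- involves. Hence `X j ^ p` is the leading term of `relPoly p b j`.
omit [RestrictedLieAlgebra k p L] in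
theorem degree_linForm_lt (x : L) (j : Fin n) :
    MonomialOrder.degLex.toSyn (MonomialOrder.degLex.degree (linForm b x)) <
      MonomialOrder.degLex.toSyn (Finsupp.single j p) := by
  have hp := (Fact.out : p.Prime).one_lt
  have hpos : (⊥ : (MonomialOrder.degLex (σ := Fin n)).syn) <
      MonomialOrder.degLex.toSyn (Finsupp.single j p) := by
    rw [bot_lt_iff_ne_bot]
    intro h
    have h0 : Finsupp.single j p = 0 := MonomialOrder.degLex.toSyn.injective (h.trans (map_zero _).symm)
    have := DFunLike.congr_fun h0 j
    simp at this
    omega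
  rw [linForm_eq]
  refine lt_of_le_of_lt MonomialOrder.degree_sum_le ?_
  rw [Finset.sup_lt_iff hpos]
  intro i _
  refine lt_of_le_of_lt (MonomialOrder.degree_smul_le.trans
    MonomialOrder.degree_X_le_single) ?_
  rw [MonomialOrder.degLex_lt_iff, Finsupp.DegLex.lt_iff]
  left
  simpa using hp

omit [Fact p.Prime] in
theorem degree_X_pow (j : Fin n) :
    MonomialOrder.degLex.degree ((X j : MvPolynomial (Fin n) k) ^ p) = Finsupp.single j p := by
  simp [MonomialOrder.degree_pow, MonomialOrder.degree_X]

theorem degree_relPoly (j : Fin n) :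
    MonomialOrder.degLex.degree (relPoly p b j) = Finsupp.single j p := by
  rw [relPoly, MonomialOrder.degree_sub_of_lt, degree_X_pow]
  rw [degree_X_pow]
  exact degree_linForm_lt b _ j

theorem monic_relPoly (j : Fin n) : MonomialOrder.degLex.Monic (relPoly p b j) := by
  rw [relPoly, MonomialOrder.Monic, MonomialOrder.leadingCoeff_sub_of_lt]
  · simp [MonomialOrder.leadingCoeff_pow]
  · rw [degree_X_pow]
    exact degree_linForm_lt b _ j

variable [IsLieAbelian L]

theorem pmap_sum_smul (s : Finset (Fin n)) (c : Fin n → k) :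
    pmap k p (∑ i ∈ s, c i • b i) = ∑ i ∈ s, c i ^ p • pmap k p (b i) := by
  classical
  induction s using Finset.induction_on with
  | empty =>
    have := pmap_add_of_abelian (k := k) (p := p) (0 : L) 0
    simpa using this
  | insert i s hi ih =>
    rw [Finset.sum_insert hi, Finset.sum_insert hi, pmap_add_of_abelian, ih]
    congr 1
    exact RestrictedLieAlgebra.pmap_smul _ _

variable [CharP k p]

/-- Frobenius on polynomials and the `p`-map of an abelian `L` are both additive and `p`-semilinear,
so the relation for `x` is a combination of the relations for the basis vectors. -/
theorem linForm_pow_sub_mem (x : L) :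
    linForm b x ^ p - linForm b (pmap k p x) ∈ Ideal.span (Set.range (relPoly p b)) := by
  have h1 : linForm b x ^ p - linForm b (pmap k p x) =
      ∑ i, C (b.repr x i ^ p) * relPoly p b i := by
    conv_lhs => rw [← b.sum_repr x]
    rw [pmap_sum_smul, map_sum, map_sum, sum_pow_char, ← Finset.sum_sub_distrib]
    refine Finset.sum_congr rfl fun i _ => ?_
    simp only [map_smul, linForm_basis, relPoly, smul_eq_C_mul, mul_sub, map_pow, mul_pow]
  rw [h1]
  exact Ideal.sum_mem _ fun i _ => Ideal.mul_mem_left _ _ (Ideal.subset_span ⟨i, rfl⟩)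

variable (p) in
/-- The map from `u(L)`, for `L` abelian, to its presentation. -/
noncomputable def toPresentation :
    RestrictedEnveloping k p L →ₐ[k] MvPolynomial (Fin n) k ⧸ Ideal.span (Set.range (relPoly p b)) :=
  lift ((Ideal.Quotient.mkₐ k (Ideal.span (Set.range (relPoly p b)))).toLinearMap ∘ₗ linForm b)
    (fun x y => by rw [trivial_lie_zero, map_zero, mul_comm, sub_self])
    (fun x => by
      have := Ideal.Quotient.eq.mpr (linForm_pow_sub_mem (p := p) b x)
      simpa using this)

variable (p) in
/-- The truncated monomials in the elements of a basis of `L`. -/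
noncomputable def truncMonomial (d : Fin n → Fin p) : RestrictedEnveloping k p L :=
  ∏ i, ι k p (b i) ^ (d i : ℕ)

theorem linearIndependent_truncMonomial : LinearIndependent k (truncMonomial p b) := by
  have h := linearIndependent_mk_monomial MonomialOrder.degLex (monic_relPoly (p := p) b)
    (degree_relPoly b) (Fact.out : p.Prime).pos
  refine LinearIndependent.of_comp (toPresentation p b).toLinearMap ?_
  have hfun : (toPresentation p b).toLinearMap ∘ truncMonomial p b = fun d =>
      Ideal.Quotient.mkₐ k (Ideal.span (Set.range (relPoly p b)))
        (monomial (Finsupp.equivFunOnFinite.symm fun j => (d j : ℕ)) 1) := by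
    funext d
    simp only [Function.comp_apply, AlgHom.toLinearMap_apply, truncMonomial, map_prod, map_pow]
    rw [monomial_eq, C_1, one_mul, Finsupp.prod_fintype _ _ (by simp), map_prod]
    refine Finset.prod_congr rfl fun i _ => ?_
    rw [map_pow]
    congr 1
    simp [toPresentation]
  rw [hfun]
  exact h

-- Mixed monomials span the polynomial ring, which surjects onto `u(L)`. One with an exponent at
-- least `p` has a factor `relPoly p b j`, which maps to zero; the others map to truncated
-- monomials.
omit [CharP k p] in
theorem span_truncMonomial : Submodule.span k (Set.range (truncMonomial p b)) = ⊤ := by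
  let π : MvPolynomial (Fin n) k →ₐ[k] RestrictedEnveloping k p L := aeval fun i => ι k p (b i)
  have hlin : ∀ x, π (linForm b x) = ι k p x := by
    intro x
    rw [linForm_eq]
    conv_rhs => rw [← b.sum_repr x, map_sum]
    simp only [map_sum, map_smul, π, aeval_X]
  have hsurj : Function.Surjective π := by
    rw [← AlgHom.range_eq_top, eq_top_iff, ← adjoin_range_ι, Algebra.adjoin_le_iff]
    rintro _ ⟨x, rfl⟩
    exact ⟨_, hlin x⟩
  have hrel : ∀ j, π (relPoly p b j) = 0 := by
    intro j
    rw [relPoly, map_sub, hlin, ← ι_pow, map_pow, aeval_X, sub_self]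
  have htop := span_eq_top_of_monic_degree MonomialOrder.degLex
    (monic_mixedMonomial _ (monic_relPoly (p := p) b))
    (degree_mixedMonomial _ (monic_relPoly (p := p) b) (degree_relPoly b))
  rw [eq_top_iff]
  rintro a -
  obtain ⟨f, rfl⟩ := hsurj a
  have hf : f ∈ Submodule.span k (Set.range (mixedMonomial p (relPoly p b))) := by
    rw [htop]; trivial
  induction hf using Submodule.span_induction with
  | mem x hx =>
    obtain ⟨d, rfl⟩ := hx
    by_cases hd : ∀ j, d j < p
    · rw [mixedMonomial_of_lt hd]
      refine Submodule.subset_span ⟨fun j => ⟨d j, hd j⟩, ?_⟩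
      simp [π, truncMonomial, aeval_monomial, Finsupp.prod_fintype]
    · push Not at hd
      obtain ⟨j, hj⟩ := hd
      have hj' : d j / p ≠ 0 := (Nat.div_pos hj (Fact.out : p.Prime).pos).ne'
      rw [mixedMonomial, map_mul, map_prod, Finset.prod_eq_zero (Finset.mem_univ j), mul_zero]
      · exact zero_mem _
      · rw [map_pow, hrel, zero_pow hj']
  | zero => simp
  | add x y _ _ hx hy => rw [map_add]; exact add_mem hx hy
  | smul a x _ hx => rw [map_smul]; exact Submodule.smul_mem _ _ hx

variable (p) in
/-- The basis of `u(L)`, for `L` abelian, of truncated monomials. -/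
noncomputable def truncBasis : Module.Basis (Fin n → Fin p) k (RestrictedEnveloping k p L) :=
  Module.Basis.mk (linearIndependent_truncMonomial b) (span_truncMonomial b).ge

@[simp]
theorem truncBasis_apply (d : Fin n → Fin p) : truncBasis p b d = truncMonomial p b d := by
  simp [truncBasis]

end RestrictedEnveloping

/-! ### Primitive elements of `u(L)` -/

namespace RestrictedEnveloping

variable {k : Type*} [Field k] {p : ℕ} [Fact p.Prime] [CharP k p] {L : Type*} [LieRing L]
  [LieAlgebra k L] [RestrictedLieAlgebra k p L] [IsLieAbelian L]

section Coordinates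

variable {n : ℕ} (b : Module.Basis (Fin n) k L)

theorem truncBasis_repr_prod_pow (m : Fin n → ℕ) (hm : ∀ i, m i < p) (β : Fin n → Fin p) :
    (truncBasis p b).repr (∏ i, ι k p (b i) ^ m i) β =
      if m = fun i => (β i : ℕ) then 1 else 0 := by
  classical
  have h : ∏ i, ι k p (b i) ^ m i = truncBasis p b fun i => ⟨m i, hm i⟩ := by
    simp [truncMonomial]
  rw [h, Module.Basis.repr_self, Finsupp.single_apply]
  congr 1
  simp [funext_iff, Fin.ext_iff]

theorem comul_truncMonomial (d : Fin n → Fin p) :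
    Coalgebra.comul (R := k) (truncMonomial p b d) =
      ∑ m ∈ Fintype.piFinset fun i => Finset.range ((d i : ℕ) + 1),
        (∏ i, ((d i : ℕ).choose (m i) : k)) •
          (∏ i, ι k p (b i) ^ m i) ⊗ₜ[k] (∏ i, ι k p (b i) ^ ((d i : ℕ) - m i)) := by
  have h1 : Coalgebra.comul (R := k) (truncMonomial p b d) =
      ∏ i, (ι k p (b i) ⊗ₜ[k] (1 : RestrictedEnveloping k p L) +
        (1 : RestrictedEnveloping k p L) ⊗ₜ[k] ι k p (b i)) ^ (d i : ℕ) := by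
    change comulHom k p L (truncMonomial p b d) = _
    rw [truncMonomial, map_prod]
    exact Finset.prod_congr rfl fun i _ => by rw [map_pow, comulHom_ι]
  have h2 : ∀ f g : Fin n → RestrictedEnveloping k p L,
      ∏ i, f i ⊗ₜ[k] g i = (∏ i, f i) ⊗ₜ[k] (∏ i, g i) := by
    intro f g
    induction (Finset.univ : Finset (Fin n)) using Finset.cons_induction with
    | empty => simp [Algebra.TensorProduct.one_def]
    | cons a s ha ih => simp only [Finset.prod_cons, ih, Algebra.TensorProduct.tmul_mul_tmul]
  rw [h1]
  simp only [add_pow]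
  rw [Finset.prod_univ_sum]
  refine Finset.sum_congr rfl fun m _ => ?_
  rw [← h2, ← Finset.prod_smul]
  refine Finset.prod_congr rfl fun i _ => ?_
  rw [Algebra.TensorProduct.tmul_pow, Algebra.TensorProduct.tmul_pow,
    Algebra.TensorProduct.tmul_mul_tmul, one_pow, one_pow, one_mul, mul_one, mul_comm,
    Nat.cast_smul_eq_nsmul, nsmul_eq_mul]

theorem repr_comul_truncMonomial (d β γ : Fin n → Fin p) :
    ((truncBasis p b).tensorProduct (truncBasis p b)).repr
        (Coalgebra.comul (R := k) (truncMonomial p b d)) (β, γ) =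
      if (fun i => (d i : ℕ)) = fun i => (β i : ℕ) + γ i then
        ∏ i, ((d i : ℕ).choose (β i) : k) else 0 := by
  classical
  have hterm : ∀ m ∈ Fintype.piFinset fun i => Finset.range ((d i : ℕ) + 1),
      ((truncBasis p b).tensorProduct (truncBasis p b)).repr
        ((∏ i, ((d i : ℕ).choose (m i) : k)) •
          (∏ i, ι k p (b i) ^ m i) ⊗ₜ[k] (∏ i, ι k p (b i) ^ ((d i : ℕ) - m i))) (β, γ) =
      if m = fun i => (β i : ℕ) then
        (if (fun i => (d i : ℕ)) = fun i => (β i : ℕ) + γ i then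
          ∏ i, ((d i : ℕ).choose (β i) : k) else 0) else 0 := by
    intro m hm
    have hle : ∀ i, m i ≤ d i := fun i =>
      Nat.lt_succ_iff.mp (Finset.mem_range.mp (Fintype.mem_piFinset.mp hm i))
    rw [map_smul, Finsupp.smul_apply, Module.Basis.tensorProduct_repr_tmul_apply,
      truncBasis_repr_prod_pow b m fun i => (hle i).trans_lt (d i).2,
      truncBasis_repr_prod_pow b _ fun i => (Nat.sub_le _ _).trans_lt (d i).2]
    by_cases h : m = fun i => (β i : ℕ)
    · subst h
      have hiff : ((fun i => (d i : ℕ) - (β i : ℕ)) = fun i => (γ i : ℕ)) ↔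
          (fun i => (d i : ℕ)) = fun i => (β i : ℕ) + γ i := by
        simp only [funext_iff]
        refine forall_congr' fun i => ?_
        have h1 : (β i : ℕ) ≤ d i := hle i
        change (d i : ℕ) - β i = γ i ↔ (d i : ℕ) = β i + γ i
        omega
      simp [hiff]
    · simp [h]
  rw [comul_truncMonomial, map_sum, Finsupp.finsetSum_apply, Finset.sum_congr rfl hterm,
    Finset.sum_ite_eq']
  split_ifs with h1 h2
  · rfl
  · rfl
  · rename_i h2
    refine (h1 (Fintype.mem_piFinset.mpr fun i => Finset.mem_range.mpr ?_)).elim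
    have h3 : (d i : ℕ) = β i + γ i := congrFun h2 i
    omega
  · rfl

/-- Only the truncated monomial with exponent `β + γ` contributes to the coefficient at `(β, γ)`;
the index `d` records that this sum stays below `p` in each coordinate. -/
theorem repr_comul (a : RestrictedEnveloping k p L) (d β γ : Fin n → Fin p)
    (h : ∀ i, (d i : ℕ) = β i + γ i) :
    ((truncBasis p b).tensorProduct (truncBasis p b)).repr
        (Coalgebra.comul (R := k) a) (β, γ) =
      (truncBasis p b).repr a d * ∏ i, ((d i : ℕ).choose (β i) : k) := by
  classical
  conv_lhs => rw [← (truncBasis p b).sum_repr a]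
  simp only [map_sum, map_smul, truncBasis_apply, Finsupp.finsetSum_apply, Finsupp.smul_apply,
    repr_comul_truncMonomial, smul_eq_mul]
  rw [Finset.sum_eq_single d]
  · rw [if_pos (funext h)]
  · intro e _ hed
    rw [if_neg, mul_zero]
    intro he
    exact hed (funext fun i => Fin.ext ((congrFun he i).trans (h i).symm))
  · simp

theorem truncBasis_repr_one (β : Fin n → Fin p) :
    (truncBasis p b).repr 1 β = if ∀ i, (β i : ℕ) = 0 then 1 else 0 := by
  have h := truncBasis_repr_prod_pow b (fun _ => 0) (fun _ => (Fact.out : p.Prime).pos) β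
  simp only [pow_zero, Finset.prod_const_one] at h
  rw [h]
  simp [funext_iff, eq_comm]

omit [Fact p.Prime] [CharP k p] in
theorem truncMonomial_of_sum_eq_one {d : Fin n → Fin p} {i : Fin n} (hi : (d i : ℕ) = 1)
    (hd : ∀ j, j ≠ i → (d j : ℕ) = 0) : truncMonomial p b d = ι k p (b i) := by
  rw [truncMonomial, Finset.prod_eq_single i, hi, pow_one]
  · intro j _ hj
    rw [hd j hj, pow_zero]
  · simp

-- Compare coefficients in `Δ(a) = a ⊗ 1 + 1 ⊗ a`. At a pair of nonzero exponents the right side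
-- vanishes, so a coefficient of `a` whose exponent splits into two nonzero parts must be zero as
-- soon as the binomial factor is nonzero. Only exponents of total degree one survive.
include b in
theorem mem_range_ι_of_comul {a : RestrictedEnveloping k p L}
    (ha : Coalgebra.comul (R := k) a = a ⊗ₜ[k] 1 + 1 ⊗ₜ[k] a) :
    a ∈ LinearMap.range (ι k p (L := L)) := by
  classical
  have hp := (Fact.out : p.Prime)
  have hcoef : ∀ d β γ : Fin n → Fin p, (∀ i, (d i : ℕ) = β i + γ i) →
      (truncBasis p b).repr a d * ∏ i, ((d i : ℕ).choose (β i) : k) =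
        (truncBasis p b).repr a β * (truncBasis p b).repr 1 γ +
        (truncBasis p b).repr 1 β * (truncBasis p b).repr a γ := by
    intro d β γ h
    rw [← repr_comul b a d β γ h, ha, map_add, Finsupp.add_apply,
      Module.Basis.tensorProduct_repr_tmul_apply, Module.Basis.tensorProduct_repr_tmul_apply]
    simp only [smul_eq_mul]
    ring
  rw [← (truncBasis p b).sum_repr a]
  refine Submodule.sum_mem _ fun d _ => ?_
  rw [truncBasis_apply]
  by_cases h0 : ∀ i, (d i : ℕ) = 0
  -- For the constant term `c` the comparison reads `c = c + c`.
  · have := hcoef d d d (by simp [h0])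
    rw [truncBasis_repr_one, if_pos h0] at this
    simp only [h0, Nat.choose_self, Nat.cast_one, Finset.prod_const_one, mul_one, one_mul] at this
    rw [left_eq_add.mp this, zero_smul]
    exact zero_mem _
  push Not at h0
  obtain ⟨i, hi⟩ := h0
  by_cases h1 : (d i : ℕ) = 1 ∧ ∀ j, j ≠ i → (d j : ℕ) = 0
  · rw [truncMonomial_of_sum_eq_one b h1.1 h1.2]
    exact Submodule.smul_mem _ _ ⟨_, rfl⟩
  -- Split off one factor: `β` is the unit vector at `i` and `γ = d - β`, so the product of
  -- binomials is `d i`, nonzero in `k` because `0 < d i < p`.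
  let β : Fin n → Fin p := fun j => if j = i then ⟨1, hp.one_lt⟩ else ⟨0, hp.pos⟩
  let γ : Fin n → Fin p := fun j =>
    if j = i then ⟨d i - 1, (Nat.sub_le _ _).trans_lt (d i).2⟩ else d j
  have hβi : (β i : ℕ) = 1 := by simp [β]
  have hβ : ∀ j, j ≠ i → (β j : ℕ) = 0 := fun j hj => by simp [β, hj]
  have hγi : (γ i : ℕ) = d i - 1 := by simp [γ]
  have hγ : ∀ j, j ≠ i → γ j = d j := fun j hj => by simp [γ, hj]
  have key := hcoef d β γ fun j => by
    by_cases hj : j = i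
    · subst hj; omega
    · rw [hβ j hj, hγ j hj, zero_add]
  have hγ0 : ¬ ∀ j, (γ j : ℕ) = 0 := by
    intro h
    refine h1 ⟨?_, fun j hj => ?_⟩
    · have := h i
      omega
    · rw [← hγ j hj, h j]
  have hβ0 : ¬ ∀ j, (β j : ℕ) = 0 := fun h => by have := h i; omega
  rw [truncBasis_repr_one, truncBasis_repr_one, if_neg hγ0, if_neg hβ0, mul_zero, zero_mul,
    add_zero, Finset.prod_eq_single i (by
      intro j _ hj
      rw [hβ j hj, Nat.choose_zero_right, Nat.cast_one]) (by simp), hβi, Nat.choose_one_right]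
    at key
  have hne : ((d i : ℕ) : k) ≠ 0 := by
    rw [Ne, CharP.cast_eq_zero_iff k p]
    exact fun h => absurd (Nat.le_of_dvd (Nat.pos_of_ne_zero hi) h) (not_le.mpr (d i).2)
  rw [(mul_eq_zero.mp key).resolve_right hne, zero_smul]
  exact zero_mem _

end Coordinates

variable [FiniteDimensional k L]

/-- Since `1 < p`, the images of the basis vectors of `L` are themselves truncated monomials, hence
independent. -/
theorem ι_injective : Function.Injective (ι k p (L := L)) := by
  classical
  have hp := (Fact.out : p.Prime)
  let b := Module.finBasis k L
  let e : Fin (Module.finrank k L) → (Fin (Module.finrank k L) → Fin p) := fun i j =>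
    if j = i then ⟨1, hp.one_lt⟩ else ⟨0, hp.pos⟩
  have he : Function.Injective e := by
    intro i j h
    by_contra hij
    have := congrFun h i
    simp [e, hij] at this
  have h := (linearIndependent_truncMonomial (p := p) b).comp e he
  have hfun : truncMonomial p b ∘ e = ι k p ∘ b := by
    funext i
    exact truncMonomial_of_sum_eq_one b (by simp [e]) fun j hj => by simp [e, hj]
  rw [hfun] at h
  exact LinearMap.injective_of_linearIndependent b.span_eq h

/-- The primitive elements of `u(L)`, for `L` abelian, are the elements of `L`. -/
theorem d₁_eq_zero_iff {a : RestrictedEnveloping k p L} :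
    d₁ k (RestrictedEnveloping k p L) a = 0 ↔ a ∈ LinearMap.range (ι k p (L := L)) := by
  have h : d₁ k (RestrictedEnveloping k p L) a = 0 ↔
      Coalgebra.comul (R := k) a = a ⊗ₜ[k] 1 + 1 ⊗ₜ[k] a := by
    rw [eq_comm (a := Coalgebra.comul (R := k) a)]
    simp [d₁, redComul, sub_sub, sub_eq_zero]
  rw [h]
  refine ⟨mem_range_ι_of_comul (Module.finBasis k L), ?_⟩
  rintro ⟨x, rfl⟩
  exact comul_ι x

end RestrictedEnveloping

/-! ### The operators `Φ_z` and their compatibility with `ρ_z` and `d¹` -/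

namespace PointedType

open RestrictedEnveloping

variable {k : Type*} [Field k] {p : ℕ} [Fact p.Prime] {𝔤 𝔥 : Type*}
    [LieRing 𝔤] [LieAlgebra k 𝔤] [RestrictedLieAlgebra k p 𝔤]
    [LieRing 𝔥] [LieAlgebra k 𝔥] [RestrictedLieAlgebra k p 𝔥] [IsLieAbelian 𝔥]
    [CharP k p] (T : PointedType k p 𝔤 𝔥)

theorem δ₁_ι (x : 𝔥) : T.δ₁ (ι k p x) = ι k p (T.ρz x) := deriv_ι _ _ _

theorem δ₁_mul (a b : T.A) : T.δ₁ (a * b) = a * T.δ₁ b + b * T.δ₁ a :=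
  (RestrictedEnveloping.deriv T.ρz T.ρz_pmap).leibniz a b

theorem δ₁_algebraMap (c : k) : T.δ₁ (algebraMap k T.A c) = 0 :=
  (RestrictedEnveloping.deriv T.ρz T.ρz_pmap).map_algebraMap c

theorem δ₁_one : T.δ₁ 1 = 0 := by simpa using T.δ₁_algebraMap 1

@[simp]
theorem δ₂_tmul (a b : T.A) : T.δ₂ (a ⊗ₜ[k] b) = T.δ₁ a ⊗ₜ[k] b + a ⊗ₜ[k] T.δ₁ b := rfl

theorem δ₂_mul (u v : T.A ⊗[k] T.A) : T.δ₂ (u * v) = u * T.δ₂ v + v * T.δ₂ u := by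
  induction u with
  | zero => simp
  | add u u' hu hu' => rw [add_mul, map_add, hu, hu', map_add]; ring
  | tmul a b =>
    induction v with
    | zero => simp
    | add v v' hv hv' => rw [mul_add, map_add, hv, hv', map_add]; ring
    | tmul c d =>
      simp only [δ₂_tmul, Algebra.TensorProduct.tmul_mul_tmul, δ₁_mul, mul_add,
        TensorProduct.add_tmul, TensorProduct.tmul_add, mul_comm c, mul_comm d]
      abel

theorem δ₂_comul (a : T.A) :
    T.δ₂ (Coalgebra.comul (R := k) a) = Coalgebra.comul (R := k) (T.δ₁ a) := by
  have ha : a ∈ Algebra.adjoin k (Set.range (ι k p (L := 𝔥))) := by simp [adjoin_range_ι]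
  induction ha using Algebra.adjoin_induction with
  | mem x hx =>
    obtain ⟨x, rfl⟩ := hx
    simp [δ₁_ι, δ₁_one]
  | algebraMap c =>
    rw [δ₁_algebraMap, Bialgebra.comul_algebraMap, Algebra.algebraMap_eq_smul_one, map_smul,
      Algebra.TensorProduct.one_def, δ₂_tmul, δ₁_one]
    simp
  | add x y _ _ hx hy => simp only [map_add, hx, hy]
  | mul x y _ _ hx hy =>
    rw [δ₁_mul, map_add, Bialgebra.comul_mul, Bialgebra.comul_mul, Bialgebra.comul_mul, δ₂_mul,
      hx, hy]

/-- In characteristic `p` the `p`-th power of a derivation is a derivation. Multiplication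
intertwines `δ₂` with `δ₁`, and `δ₂` is a sum of two commuting operators, so its `p`-th power is the
sum of their `p`-th powers. -/
theorem δ₁_pow_p_mul (a b : T.A) :
    (T.δ₁ ^ p) (a * b) = a * (T.δ₁ ^ p) b + b * (T.δ₁ ^ p) a := by
  have hμ : ∀ (n : ℕ) (u : T.A ⊗[k] T.A), (T.δ₁ ^ n) (LinearMap.mul' k T.A u) =
      LinearMap.mul' k T.A ((T.δ₂ ^ n) u) := by
    intro n
    induction n with
    | zero => simp
    | succ n ih =>
      intro u
      rw [pow_succ, pow_succ, Module.End.mul_apply, Module.End.mul_apply, ← ih]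
      congr 1
      induction u with
      | zero => simp
      | add u v hu hv => simp only [map_add, hu, hv]
      | tmul a b => simp [δ₁_mul, mul_comm, add_comm]
  have : CharP (Module.End k (T.A ⊗[k] T.A)) p :=
    charP_of_injective_algebraMap (algebraMap k _).injective p
  have hc : Commute (T.δ₁.rTensor T.A) (T.δ₁.lTensor T.A) := by
    refine LinearMap.ext fun u => ?_
    induction u with
    | zero => simp
    | add u v hu hv => simp only [map_add, hu, hv]
    | tmul a b => simp
  have hpow : T.δ₂ ^ p = (T.δ₁ ^ p).rTensor T.A + (T.δ₁ ^ p).lTensor T.A := by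
    rw [δ₂, add_pow_char_of_commute p hc, LinearMap.rTensor_pow, LinearMap.lTensor_pow]
  have := hμ p (a ⊗ₜ b)
  rw [hpow] at this
  simp only [LinearMap.mul'_apply, LinearMap.add_apply, LinearMap.rTensor_tmul,
    LinearMap.lTensor_tmul, map_add] at this
  rw [this, mul_comm b, add_comm]

theorem δ₁_pow_ι (n : ℕ) (x : 𝔥) : (T.δ₁ ^ n) (ι k p x) = ι k p ((T.ρz ^ n) x) := by
  induction n with
  | zero => simp
  | succ n ih => rw [pow_succ', Module.End.mul_apply, ih, pow_succ', Module.End.mul_apply, δ₁_ι]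

omit [Fact p.Prime] [IsLieAbelian 𝔥] [CharP k p] in
theorem ρz_pow_p (x : 𝔥) : (T.ρz ^ p) x + T.lam • T.ρz x = 0 := by
  have h := congrArg (fun w => T.ρ w x) T.z_rel
  simpa [T.map_pmap] using h

/-- The left side is a derivation in `a`, and on the generators from `𝔥` it vanishes by the relation
`z ^ p + lam z = 0`. -/
theorem δ₁_pow_p (a : T.A) : (T.δ₁ ^ p) a + T.lam • T.δ₁ a = 0 := by
  have ha : a ∈ Algebra.adjoin k (Set.range (ι k p (L := 𝔥))) := by simp [adjoin_range_ι]
  induction ha using Algebra.adjoin_induction with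
  | mem x hx =>
    obtain ⟨x, rfl⟩ := hx
    rw [δ₁_pow_ι, δ₁_ι, ← map_smul, ← map_add, ρz_pow_p, map_zero]
  | algebraMap c =>
    have h : (T.δ₁ ^ p) (algebraMap k T.A c) = 0 := by
      rw [← pow_sub_one_mul (Fact.out : p.Prime).ne_zero, Module.End.mul_apply, δ₁_algebraMap,
        map_zero]
    rw [h, δ₁_algebraMap, smul_zero, add_zero]
  | add x y _ _ hx hy =>
    rw [map_add, map_add, smul_add, add_add_add_comm, hx, hy, add_zero]
  | mul x y _ _ hx hy =>
    have : (T.δ₁ ^ p) (x * y) + T.lam • T.δ₁ (x * y) =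
        x * ((T.δ₁ ^ p) y + T.lam • T.δ₁ y) + y * ((T.δ₁ ^ p) x + T.lam • T.δ₁ x) := by
      rw [δ₁_pow_p_mul, δ₁_mul, smul_add, mul_add, mul_add, mul_smul_comm, mul_smul_comm]
      abel
    rw [this, hx, hy, mul_zero, mul_zero, add_zero]

theorem Φ₁_eq (a : T.A) : T.Φ₁ a = a ^ p + (T.δ₁ ^ (p - 1)) a + T.lam • a :=
  zOperator_eq p _ _ _ _

theorem Φ₂_eq (u : T.A ⊗[k] T.A) : T.Φ₂ u = u ^ p + (T.δ₂ ^ (p - 1)) u + T.lam • u :=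
  zOperator_eq p _ _ _ _

theorem Φ₂_add (u v : T.A ⊗[k] T.A) : T.Φ₂ (u + v) = T.Φ₂ u + T.Φ₂ v :=
  zOperator_add p _ (fun a b => add_pow_char a b p) _ _ u v

theorem Φ₂_sub (u v : T.A ⊗[k] T.A) : T.Φ₂ (u - v) = T.Φ₂ u - T.Φ₂ v := by
  rw [eq_sub_iff_add_eq, ← Φ₂_add, sub_add_cancel]

theorem δ₁_pow_p_sub_one (a : T.A) : T.δ₁ ((T.δ₁ ^ (p - 1)) a) = (T.δ₁ ^ p) a := by
  rw [← Module.End.mul_apply, ← pow_succ', Nat.sub_add_cancel (Fact.out : p.Prime).one_le]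

/-- A derivation kills `p`-th powers in characteristic `p`; the other two terms give `δ₁ ^ p + lam
δ₁ = 0`. -/
theorem δ₁_Φ₁ (a : T.A) : T.δ₁ (T.Φ₁ a) = 0 := by
  have h : T.δ₁ (a ^ p) = 0 := by
    have := (RestrictedEnveloping.deriv T.ρz T.ρz_pmap).leibniz_pow a p
    refine this.trans ?_
    rw [← Nat.cast_smul_eq_nsmul k, CharP.cast_eq_zero, zero_smul]
  rw [Φ₁_eq, map_add, map_add, h, zero_add, map_smul, δ₁_pow_p_sub_one, δ₁_pow_p]

theorem Φ₂_comul (a : T.A) :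
    T.Φ₂ (Coalgebra.comul (R := k) a) = Coalgebra.comul (R := k) (T.Φ₁ a) := by
  have h : ∀ n : ℕ, (T.δ₂ ^ n) (Coalgebra.comul (R := k) a) =
      Coalgebra.comul (R := k) ((T.δ₁ ^ n) a) := by
    intro n
    induction n with
    | zero => simp
    | succ n ih =>
      rw [pow_succ', pow_succ', Module.End.mul_apply, Module.End.mul_apply, ih, δ₂_comul]
  rw [Φ₂_eq, Φ₁_eq, h, map_add, map_add, map_smul, Bialgebra.comul_pow]

theorem Φ₂_tmul_one (a : T.A) : T.Φ₂ (a ⊗ₜ[k] 1) = T.Φ₁ a ⊗ₜ[k] 1 := by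
  have h : ∀ n : ℕ, (T.δ₂ ^ n) (a ⊗ₜ[k] 1) = (T.δ₁ ^ n) a ⊗ₜ[k] 1 := by
    intro n
    induction n with
    | zero => simp
    | succ n ih =>
      rw [pow_succ', pow_succ', Module.End.mul_apply, Module.End.mul_apply, ih, δ₂_tmul, δ₁_one,
        TensorProduct.tmul_zero, add_zero]
  rw [Φ₂_eq, Φ₁_eq, h, Algebra.TensorProduct.tmul_pow, one_pow, TensorProduct.add_tmul,
    TensorProduct.add_tmul, TensorProduct.smul_tmul']

theorem Φ₂_one_tmul (a : T.A) : T.Φ₂ (1 ⊗ₜ[k] a) = 1 ⊗ₜ[k] T.Φ₁ a := by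
  have h : ∀ n : ℕ, (T.δ₂ ^ n) (1 ⊗ₜ[k] a) = 1 ⊗ₜ[k] (T.δ₁ ^ n) a := by
    intro n
    induction n with
    | zero => simp
    | succ n ih =>
      rw [pow_succ', pow_succ', Module.End.mul_apply, Module.End.mul_apply, ih, δ₂_tmul, δ₁_one,
        TensorProduct.zero_tmul, zero_add]
  rw [Φ₂_eq, Φ₁_eq, h, Algebra.TensorProduct.tmul_pow, one_pow, TensorProduct.tmul_add,
    TensorProduct.tmul_add, TensorProduct.tmul_smul]

/-- `Φ_z` commutes with every algebra map that intertwines the derivations. The maps `Δ`, `a ↦ a ⊗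
1` and `a ↦ 1 ⊗ a` are of this kind, and `Φ₂` is additive, though not linear in general. -/
theorem d₁_Φ₁ (a : T.A) : d₁ k T.A (T.Φ₁ a) = T.Φ₂ (d₁ k T.A a) := by
  have h : ∀ c : T.A, d₁ k T.A c =
      (c ⊗ₜ[k] 1 + 1 ⊗ₜ[k] c) - Coalgebra.comul (R := k) c := fun c => by
    simp only [d₁, redComul, LinearMap.neg_apply, LinearMap.sub_apply, LinearMap.flip_apply,
      TensorProduct.mk_apply]
    abel
  rw [h, h, Φ₂_sub, Φ₂_add, Φ₂_comul, Φ₂_tmul_one, Φ₂_one_tmul]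

omit [IsLieAbelian 𝔥] in
theorem ι_mem_augIdeal (x : 𝔥) : ι k p x ∈ augIdeal k T.A := counit_ι x

/-! ### Equivalence classes of pairs, and orbits -/

theorem cls_eq_iff (P Q : T.E₂) : T.cls P = T.cls Q ↔ ∃ a ∈ augIdeal k T.A,
    (Q.1.1 : T.A) - P.1.1 = T.Φ₁ a ∧ (Q.1.2 : T.A ⊗[k] T.A) - P.1.2 = d₁ k T.A a :=
  Quotient.eq

/-- Equivalent pairs have cohomologous cocycles, so whether a class contains a pair with `χ` in `B²`
can be tested on any representative. -/
theorem mem_Hgh_iff (P : T.E₂) :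
    T.cls P ∈ T.Hgh ↔ (Submodule.Quotient.mk P.1.2 : H₂ k T.A) = 0 := by
  have hL : ∀ Q : T.E₂, Q ∈ T.L₂ ↔ (Submodule.Quotient.mk Q.1.2 : H₂ k T.A) = 0 := fun Q =>
    (Submodule.Quotient.mk_eq_zero ((B₂ k T.A).submoduleOf (Z₂ k T.A))).symm
  constructor
  · rintro ⟨Q, hQ, h⟩
    exact (congrArg T.qBA h).symm.trans ((hL Q).mp hQ)
  · exact fun h => ⟨P, (hL P).mpr h, rfl⟩

omit [CharP k p] in
theorem orbit_mk_eq_iff (x y : T.kerρz) :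
    (Quotient.mk _ x : T.Orbits) = Quotient.mk _ y ↔ ∃ v : 𝔥, (y : 𝔥) = x + T.Φ₀ v := by
  rw [eq_comm, Quotient.eq]
  change y ∈ AddAction.orbit 𝔥 x ↔ _
  rw [AddAction.mem_orbit_iff]
  refine exists_congr fun v => ?_
  rw [Subtype.ext_iff, eq_comm]
  rfl

variable {T} in
theorem q_ne_zero (c : T.HT) : T.q c ≠ 0 := by
  obtain ⟨c, hc⟩ := c
  induction c using Quotient.inductionOn with
  | h P => exact fun h => hc ((T.mem_Hgh_iff P).mpr h)

/-! ### The fibers of `q` -/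

section Fiber

variable [FiniteDimensional k 𝔥]

/-- The pair `(Θ₀ + x, χ₀)` for `x` in `Ker ρ_z`. -/
def translate (P₀ : T.E₂) (x : T.kerρz) : T.E₂ :=
  ⟨(⟨P₀.1.1 + ι k p (x : 𝔥), add_mem P₀.1.1.2 (T.ι_mem_augIdeal _)⟩, P₀.1.2), by
    have hx : T.ρz (x : 𝔥) = 0 := x.2
    refine ⟨?_, ?_⟩
    · change T.δ₁ ((P₀.1.1 : T.A) + ι k p (x : 𝔥)) = 0
      rw [map_add, P₀.2.1, δ₁_ι, hx, map_zero, add_zero]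
    · change T.Φ₂ P₀.1.2 = d₁ k T.A ((P₀.1.1 : T.A) + ι k p (x : 𝔥))
      rw [map_add, d₁_eq_zero_iff.mpr ⟨_, rfl⟩, add_zero]
      exact P₀.2.2⟩

/-- Both pairs have the same cocycle, so an element `a` relating them satisfies `d¹(a) = 0`. It is
then primitive and comes from `𝔥`, where `Φ₁` is `Φ₀`. -/
theorem cls_translate_eq_iff (P₀ : T.E₂) (x y : T.kerρz) :
    T.cls (T.translate P₀ x) = T.cls (T.translate P₀ y) ↔
      ∃ v : 𝔥, (y : 𝔥) = x + T.Φ₀ v := by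
  rw [cls_eq_iff]
  change (∃ a ∈ augIdeal k T.A, ((P₀.1.1 : T.A) + ι k p (y : 𝔥)) - (P₀.1.1 + ι k p (x : 𝔥)) =
    T.Φ₁ a ∧ (P₀.1.2 : T.A ⊗[k] T.A) - P₀.1.2 = d₁ k T.A a) ↔ _
  simp only [add_sub_add_left_eq_sub, sub_self]
  constructor
  · rintro ⟨a, -, h1, h2⟩
    obtain ⟨v, rfl⟩ := d₁_eq_zero_iff.mp h2.symm
    rw [Φ₁_ι, ← map_sub] at h1
    exact ⟨v, by rw [← ι_injective h1, add_sub_cancel]⟩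
  · rintro ⟨v, hv⟩
    exact ⟨ι k p v, T.ι_mem_augIdeal v, by rw [hv, map_add, add_sub_cancel_left, Φ₁_ι],
      (d₁_eq_zero_iff.mpr ⟨v, rfl⟩).symm⟩

theorem exists_cls_eq_translate (P₀ P : T.E₂)
    (h : (Submodule.Quotient.mk P.1.2 : H₂ k T.A) = Submodule.Quotient.mk P₀.1.2) :
    ∃ x, T.cls P = T.cls (T.translate P₀ x) := by
  obtain ⟨a, ha, h⟩ := (Submodule.Quotient.eq _).mp h.symm
  replace h : d₁ k T.A a = (P₀.1.2 : T.A ⊗[k] T.A) - P.1.2 := h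
  -- After the move by `a` the cocycle is `χ₀`, so `d¹` takes the value `Φ_z(χ₀)` both on the new
  -- first component and on `Θ₀`.
  have hd : d₁ k T.A ((P.1.1 : T.A) + T.Φ₁ a - P₀.1.1) = 0 := by
    rw [map_sub, map_add, d₁_Φ₁, h, Φ₂_sub, ← P.2.2, ← P₀.2.2]
    abel
  obtain ⟨x, hx⟩ := d₁_eq_zero_iff.mp hd
  have hρ : T.ρz x = 0 := by
    refine ι_injective (k := k) (p := p) ?_
    rw [map_zero, ← δ₁_ι, hx, map_sub, map_add, P.2.1, P₀.2.1, δ₁_Φ₁]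
    simp
  refine ⟨⟨x, hρ⟩, (T.cls_eq_iff _ _).mpr ⟨a, ha, ?_, h.symm⟩⟩
  change (P₀.1.1 : T.A) + ι k p x - P.1.1 = _
  rw [hx]
  abel

variable {T} {ξ : H₂ k T.A}

/-- The bijection from orbits in `Ker ρ_z` onto a nonzero fiber of `q`. -/
noncomputable def fiberEquiv (hξ : ξ ≠ 0) (P₀ : T.E₂)
    (h₀ : (Submodule.Quotient.mk P₀.1.2 : H₂ k T.A) = ξ) :
    T.Orbits ≃ {c : T.HT // T.q c = ξ} :=
  Equiv.ofBijective
    -- The hypothesis `ξ ≠ 0` keeps the class of each translate out of `ℋ²(𝔤, 𝔥)`.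
    (Quotient.lift (fun x => ⟨⟨T.cls (T.translate P₀ x), fun h =>
        hξ (h₀.symm.trans ((T.mem_Hgh_iff (T.translate P₀ x)).mp h))⟩, h₀⟩) (fun x y hxy => by
      refine Subtype.ext (Subtype.ext ((T.cls_translate_eq_iff P₀ x y).mpr ?_))
      exact (T.orbit_mk_eq_iff x y).mp (Quotient.sound hxy)))
    (by
      constructor
      · intro u v
        refine Quotient.inductionOn₂ u v fun x y h => ?_
        have h' := congrArg (fun c => (c.1.1 : T.HBA)) h
        exact (T.orbit_mk_eq_iff x y).mpr ((T.cls_translate_eq_iff P₀ x y).mp h')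
      · rintro ⟨⟨c, hc⟩, hq⟩
        induction c using Quotient.inductionOn with
        | h P =>
          obtain ⟨x, hx⟩ := T.exists_cls_eq_translate P₀ P (Eq.trans hq h₀.symm)
          exact ⟨Quotient.mk _ x, Subtype.ext (Subtype.ext hx.symm)⟩)

theorem fiberEquiv_mk (hξ : ξ ≠ 0) (P₀ : T.E₂)
    (h₀ : (Submodule.Quotient.mk P₀.1.2 : H₂ k T.A) = ξ) (x : T.kerρz) :
    ((fiberEquiv hξ P₀ h₀ (Quotient.mk _ x)).1.1 : T.HBA) = T.cls (T.translate P₀ x) := rfl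

-- The image of `Φ₀` always lies in the kernel and is the orbit of `0`; the other orbits are its
-- cosets.
omit [CharP k p] [FiniteDimensional k 𝔥] in
variable (T) in
theorem kerρz_eq_range_Φ₀_iff :
    (T.kerρz : Set 𝔥) = Set.range T.Φ₀ ↔ Subsingleton T.Orbits := by
  constructor
  · intro h
    refine ⟨fun u v => Quotient.inductionOn₂ u v fun x y => ?_⟩
    rw [orbit_mk_eq_iff]
    have hxy : (y : 𝔥) - x ∈ (T.kerρz : Set 𝔥) := sub_mem y.2 x.2
    rw [h] at hxy
    obtain ⟨v, hv⟩ := hxy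
    exact ⟨v, by rw [hv, add_sub_cancel]⟩
  · intro h
    ext x
    constructor
    · intro hx
      obtain ⟨v, hv⟩ := (T.orbit_mk_eq_iff 0 ⟨x, hx⟩).mp (Subsingleton.elim _ _)
      exact ⟨v, by simpa using hv.symm⟩
    · rintro ⟨v, rfl⟩
      exact T.ρz_Φ₀ v

theorem q_injective_iff (hξ : ξ ≠ 0) (P₀ : T.E₂)
    (h₀ : (Submodule.Quotient.mk P₀.1.2 : H₂ k T.A) = ξ) :
    Function.Injective T.q ↔ (T.kerρz : Set 𝔥) = Set.range T.Φ₀ := by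
  rw [kerρz_eq_range_Φ₀_iff]
  constructor
  · intro hq
    have : Subsingleton {c : T.HT // T.q c = ξ} :=
      ⟨fun c c' => Subtype.ext (hq (c.2.trans c'.2.symm))⟩
    exact (fiberEquiv hξ P₀ h₀).subsingleton
  -- Injectivity concerns all fibers, not only the one over `ξ`. A representative of `c` serves as
  -- base point for its own fiber, which lies over a nonzero class by `q_ne_zero`.
  · rintro hs ⟨c, hc⟩ c' h
    induction c using Quotient.inductionOn with
    | h P =>
      have : Subsingleton {c : T.HT // T.q c = T.q ⟨T.cls P, hc⟩} :=
        (fiberEquiv (q_ne_zero ⟨T.cls P, hc⟩) P rfl).symm.subsingleton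
      exact congrArg Subtype.val
        (Subsingleton.elim (⟨_, rfl⟩ : {c : T.HT // T.q c = T.q ⟨T.cls P, hc⟩}) ⟨c', h.symm⟩)

end Fiber

theorem exists_pair_of_isAdmissible {ξ : H₂ k T.A} (h : T.IsAdmissible ξ) :
    ∃ P₀ : T.E₂, (Submodule.Quotient.mk P₀.1.2 : H₂ k T.A) = ξ := by
  obtain ⟨χ, hχ, a, ha, h1, h2⟩ := h
  exact ⟨⟨(⟨a, ha⟩, χ), h2, h1⟩, hχ⟩

end PointedType

end ConnHopf

open ConnHopf
theorem lemma5p4 {k : Type*} [Field k] [PerfectField k] {p : ℕ} [Fact p.Prime] [CharP k p]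
    {𝔤 𝔥 : Type*}
    [LieRing 𝔤] [LieAlgebra k 𝔤] [RestrictedLieAlgebra k p 𝔤]
    [LieRing 𝔥] [LieAlgebra k 𝔥] [RestrictedLieAlgebra k p 𝔥] [IsLieAbelian 𝔥]
    [FiniteDimensional k 𝔥]
    (T : PointedType k p 𝔤 𝔥) (ξ : H₂ k T.A) (hξ : ξ ≠ 0) (hadm : T.IsAdmissible ξ) :
    (∃ P₀ : T.E₂, (Submodule.Quotient.mk P₀.1.2 : H₂ k T.A) = ξ) ∧
    (∀ P₀ : T.E₂, (Submodule.Quotient.mk P₀.1.2 : H₂ k T.A) = ξ →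
      ∃ e : T.Orbits ≃ {c : T.HT // T.q c = ξ}, ∀ x : T.kerρz,
        ∃ P : T.E₂,
          (P.1.1 : T.A) = (P₀.1.1 : T.A) + RestrictedEnveloping.ι k p (x : 𝔥) ∧
          P.1.2 = P₀.1.2 ∧
          ((e (Quotient.mk _ x)).1.1 : T.HBA) = T.cls P) ∧
    (Function.Injective T.q ↔ (T.kerρz : Set 𝔥) = Set.range T.Φ₀) := by
  obtain ⟨P₀, h₀⟩ := T.exists_pair_of_isAdmissible hadm
  exact ⟨⟨P₀, h₀⟩, fun P h => ⟨PointedType.fiberEquiv hξ P h, fun x =>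
    ⟨T.translate P x, rfl, rfl, PointedType.fiberEquiv_mk hξ P h x⟩⟩,
    PointedType.q_injective_iff hξ P₀ h₀⟩
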